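/- Let $G$ be a finite group with exponent $\exp(G)$ and let $m$ be an integer. For $g\in G$ let $C_G(g)$ be its centralizer, and let $\mathrm{Irr}(H)$ be the set of irreducible complex characters of a group $H$. For a class function $f$ on $H$ and an integer $r$ put $(\psi^r f)(x)=f(x^r)$. For $g\in G$ and a character $\eta$ of $C_G(g)$ let $$\nu_m(g,\eta)=\frac1{|C_G(g)|}\sum_{x\in G,\ x^m=(gx)^m}\eta(x^m)$$ (the $m$-th Frobenius--Schur indicator of the module over the Drinfeld double of $G$ attached to $(g,\eta)$). For $z\in G$ let $\gamma_m^z$ be the class function on $C_G(z)$ given by $\gamma_m^z(g)=|\{x\in G : x^m=(gx)^m=z\}|$, and let $\beta_m(z,\chi)\in\mathbb C$ be the coefficients in its expansion $\gamma_m^z=\sum_{\chi\in\mathrm{Irr}(C_G(z))}\beta_m(z,\chi)\,\chi$. For an integer $r$ coprime to $\exp(G)$ let $\sigma_r$ be the automorphism of the cyclotomic field $\mathbb Q_{\exp(G)}\subset\mathbb C$ generated by the $\exp(G)$-th roots of unity that sends each such root of unity to its $r$-th power; note that $C_G(g^r)=C_G(g)$ for such $r$. Call $g,g'\in G$ rationally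 conjugate if $g'$ is conjugate to $g^r$ for some integer $r$ coprime to the order of $g$. Then: (1) For every integer $r$ coprime to $\exp(G)$, every $g\in G$ and every $\eta\in\mathrm{Irr}(C_G(g))$, the number $\nu_m(g,\eta)$ lies in $\mathbb Q_{\exp(G)}$ and $$\nu_m(g^r,\eta)=\nu_m(g,\psi^r\eta)=\sigma_r\,\nu_m(g,\eta).$$ In particular the set $\{\nu_m(g,\eta) : \eta\in\mathrm{Irr}(C_G(g))\}$ depends only on the rational conjugacy class of $g$. (2) For every integer $r$ coprime to $\exp(G)$, every $z\in G$ and every $\chi\in\mathrm{Irr}(C_G(z))$, the function $\psi^r\chi$ is an irreducible character of $C_G(z)$, the number $\beta_m(z,\chi)$ lies in $\mathbb Q_{\exp(G)}$ and $$\beta_m(z^r,\chi)=\beta_m(z,\psi^r\chi)=\sigma_r\,\beta_m(z,\chi).$$ In particular the set $\{\beta_m(z,\chi) : \chi\in\mathrm{Irr}(C_G(z))\}$ depends only on the rational conjugacy class of $z$. -/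

import Mathlib

namespace DoubleIndicator

open scoped MonoidAlgebra

section Characters

variable {H : Type*} [Group H]

/-- The set of irreducible complex characters of a group: the characters of the irreducible
finite-dimensional complex representations. -/
def Irr (H : Type*) [Group H] : Set (H → ℂ) :=
  {χ | ∃ (n : ℕ) (ρ : Representation ℂ H (Fin n → ℂ)), ρ.IsIrreducible ∧ ρ.character = χ}

/-- The space of complex class functions on a group. -/
def ClassFun (H : Type*) [Group H] : Submodule ℂ (H → ℂ) where
  carrier := {f | ∀ t x : H, f (t * x * t⁻¹) = f x}
  add_mem' := fun hf hg t x => by simp [hf t x, hg t x]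
  zero_mem' := fun _ _ => rfl
  smul_mem' := fun c f hf t x => by simp [hf t x]

theorem Irr.mem_classFun {χ : H → ℂ} (h : χ ∈ Irr H) : χ ∈ ClassFun H := by
  obtain ⟨n, ρ, -, rfl⟩ := h
  intro t x
  exact ρ.char_conj x t

/-- Irreducible characters, as class functions. -/
def Irr.toClassFun (χ : Irr H) : ClassFun H := ⟨χ, Irr.mem_classFun χ.2⟩

theorem character_mem_irr {V : Type*} [AddCommGroup V] [Module ℂ V] [FiniteDimensional ℂ V]
    (ρ : Representation ℂ H V) (hρ : ρ.IsIrreducible) : ρ.character ∈ Irr H := by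
  let e : V ≃ₗ[ℂ] (Fin (Module.finrank ℂ V) → ℂ) := (Module.finBasis ℂ V).equivFun
  let ρ' : Representation ℂ H (Fin (Module.finrank ℂ V) → ℂ) :=
    (e.conjAlgEquiv ℂ).toMonoidHom.comp ρ
  let φ : ρ.Equiv ρ' := Representation.Equiv.mk e (by
    intro g
    ext x : 1
    simp [ρ'])
  refine ⟨_, ρ', ?_, (Representation.char_iso φ).symm⟩
  rw [Representation.irreducible_iff_isSimpleModule_asModule] at hρ ⊢
  have hb : Function.Bijective
      (Representation.IntertwiningMap.equivLinearMapAsModule ρ' ρ φ.symm.toIntertwiningMap) :=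
    φ.symm.toLinearEquiv.bijective
  exact IsSimpleModule.congr (LinearEquiv.ofBijective _ hb)

theorem irr_orthonormal [Fintype H] (χ ψ : Irr H) :
    (Nat.card H : ℂ)⁻¹ * ∑ g : H, ψ.1 g * χ.1 g⁻¹ = if χ = ψ then 1 else 0 := by
  classical
  obtain ⟨χ, n, ρ, hρ, rfl⟩ := χ
  obtain ⟨ψ, m, σ, hσ, rfl⟩ := ψ
  have : Invertible (Nat.card H : ℂ) := invertibleOfNonzero (by simp)
  by_cases he : Nonempty (ρ.Equiv σ)
  · have := Representation.char_iso he.some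
    simp only [this, if_true]
    rw [Representation.char_orthonormal, if_pos ⟨.refl σ⟩]
  · rw [Representation.char_orthonormal, if_neg he, if_neg]
    intro h
    have h' : ρ.character = σ.character := congrArg Subtype.val h
    have h1 := Representation.char_orthonormal ρ ρ
    have h2 := Representation.char_orthonormal σ ρ
    rw [if_pos ⟨.refl ρ⟩] at h1
    rw [if_neg he, ← h', h1] at h2
    exact one_ne_zero h2

/-- The linear functional `f ↦ ⟨f, χ⟩`. -/
noncomputable def pairing [Fintype H] (χ : Irr H) : Module.Dual ℂ (ClassFun H) where
  toFun f := (Nat.card H : ℂ)⁻¹ * ∑ g : H, f.1 g * χ.1 g⁻¹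
  map_add' f g := by simp [add_mul, Finset.sum_add_distrib, mul_add]
  map_smul' c f := by
    simp only [SetLike.val_smul, Pi.smul_apply, smul_eq_mul, RingHom.id_apply, mul_assoc,
      ← Finset.mul_sum]
    ring

theorem irr_linearIndependent [Finite H] :
    LinearIndependent ℂ (Irr.toClassFun : Irr H → ClassFun H) := by
  have := Fintype.ofFinite H
  refine LinearIndependent.of_pairwise_dual_eq_zero_one _ pairing ?_ ?_
  · intro i j hij
    exact (irr_orthonormal i j).trans (if_neg hij)
  · intro i
    exact (irr_orthonormal i i).trans (if_pos rfl)

theorem eq_zero_of_pairing_eq_zero [Fintype H] (f : ClassFun H)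
    (h : ∀ χ : Irr H, pairing χ f = 0) : f = 0 := by
  classical
  have hf := f.2
  let a : ℂ[H] := ∑ g : H, MonoidAlgebra.single g⁻¹ (f.1 g)
  have hcomm : ∀ b : ℂ[H], a * b = b * a := by
    intro b
    induction b using MonoidAlgebra.induction_on with
    | of t =>
      simp only [a, Finset.sum_mul, Finset.mul_sum, MonoidAlgebra.of_apply,
        MonoidAlgebra.single_mul_single, one_mul, mul_one]
      refine Finset.sum_equiv (MulAut.conj t⁻¹).toEquiv (by simp) ?_
      intro g _
      have := hf t⁻¹ g
      simp only [inv_inv] at this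
      rw [mul_assoc] at this
      simp [this, mul_assoc]
    | add x y hx hy => rw [mul_add, add_mul, hx, hy]
    | smul r x hx => rw [Algebra.mul_smul_comm, Algebra.smul_mul_assoc, hx]
  have hkill : ∀ S : Submodule ℂ[H] ℂ[H], IsSimpleModule ℂ[H] S → ∀ x ∈ S, a * x = 0 := by
    intro S hS
    have : Module.Finite ℂ S := Module.Finite.trans ℂ[H] S
    let ρ : Representation ℂ H S := Representation.ofModule' S
    have hρa : ∀ (b : ℂ[H]) (x : S), ρ.asAlgebraHom b x = b • x := by
      intro b x
      simp [ρ, Representation.ofModule', Representation.asAlgebraHom_def]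
    have hρ : ρ.IsIrreducible := by
      rw [Representation.irreducible_iff_isSimpleModule_asModule]
      exact IsSimpleModule.congr (N := S)
        { ρ.asModuleEquiv.toAddEquiv with map_smul' := fun b x => hρa b x }
    obtain ⟨c, hc⟩ := (IsSimpleModule.algebraMap_end_bijective_of_isAlgClosed (A := ℂ[H])
      (V := S) ℂ).2
      { toFun := fun x => a • x
        map_add' := smul_add a
        map_smul' := fun b x => by
          simp only [RingHom.id_apply, smul_smul, hcomm b] }
    have hc' : ∀ x : S, a • x = c • x := fun x => (LinearMap.congr_fun hc x).symm
    have htr : LinearMap.trace ℂ S (ρ.asAlgebraHom a) = 0 := by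
      have h0 := h ⟨_, character_mem_irr ρ hρ⟩
      have h1 : (Nat.card H : ℂ) ≠ 0 := by simp
      simpa [pairing, a, Representation.character, map_sum] using h0
    have hac : ρ.asAlgebraHom a = c • LinearMap.id := by
      ext1 x
      rw [hρa, hc']
      rfl
    have : Nontrivial S := IsSimpleModule.nontrivial ℂ[H] S
    rw [hac, map_smul, LinearMap.trace_id, smul_eq_mul, mul_eq_zero, Nat.cast_eq_zero,
      or_iff_left Module.finrank_pos.ne'] at htr
    intro x hx
    have := hc' ⟨x, hx⟩
    rw [htr, zero_smul] at this
    exact congrArg Subtype.val this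
  have hspan : (⊤ : Submodule ℂ[H] ℂ[H]) ≤ LinearMap.ker
      ({ toFun := fun x => a * x
         map_add' := mul_add a
         map_smul' := fun b x => by
          simp only [smul_eq_mul, RingHom.id_apply, ← mul_assoc, hcomm b] } :
        ℂ[H] →ₗ[ℂ[H]] ℂ[H]) := by
    have : NeZero (Nat.card H : ℂ) := ⟨by simp⟩
    rw [← IsSemisimpleModule.sSup_simples_eq_top ℂ[H] ℂ[H]]
    exact sSup_le fun S hS x hx => hkill S hS x hx
  have ha : a = 0 := by simpa using hspan (Submodule.mem_top (x := (1 : ℂ[H])))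
  ext g
  have := congrArg (fun b : ℂ[H] => b.coeff g⁻¹) ha
  simpa [a, Finsupp.finsetSum_apply, Finsupp.single_apply] using this

theorem irr_span [Finite H] :
    ⊤ ≤ Submodule.span ℂ (Set.range (Irr.toClassFun : Irr H → ClassFun H)) := by
  classical
  have := Fintype.ofFinite H
  have : Finite (Irr H) := irr_linearIndependent.finite
  have := Fintype.ofFinite (Irr H)
  intro f _
  have : f - ∑ χ : Irr H, pairing χ f • Irr.toClassFun χ = 0 := by
    refine eq_zero_of_pairing_eq_zero _ fun ψ => ?_
    have hp : ∀ χ, pairing ψ (Irr.toClassFun χ) = if ψ = χ then 1 else 0 :=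
      fun χ => irr_orthonormal ψ χ
    simp [hp]
  rw [sub_eq_zero.1 this]
  exact Submodule.sum_mem _ fun χ _ => Submodule.smul_mem _ _ (Submodule.subset_span ⟨χ, rfl⟩)

/-- The irreducible characters of a finite group as a basis of the space of class functions. -/
noncomputable def irrBasis (H : Type*) [Group H] [Finite H] : Module.Basis (Irr H) ℂ (ClassFun H) :=
  Module.Basis.mk irr_linearIndependent irr_span

end Characters

section Cyclotomic

/-- The cyclotomic field `ℚ(ζₙ)`, as the subfield of `ℂ` generated by the `n`-th roots of unity. -/
noncomputable def CF (n : ℕ) : IntermediateField ℚ ℂ :=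
  IntermediateField.adjoin ℚ {ζ : ℂ | ζ ^ n = 1}

instance (n : ℕ) [NeZero n] : IsCyclotomicExtension {n} ℚ (CF n) := by
  have hζ := Complex.isPrimitiveRoot_exp n (NeZero.ne n)
  have h := (IntermediateField.isCyclotomicExtension_singleton_iff_eq_adjoin n ℚ ℂ (CF n) hζ).2 ?_
  · convert! h
  refine le_antisymm (IntermediateField.adjoin_le_iff.2 fun x hx => ?_)
    (IntermediateField.adjoin.mono _ _ _ (by simpa using hζ.pow_eq_one))
  obtain ⟨i, -, rfl⟩ := hζ.eq_pow_of_pow_eq_one hx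
  exact pow_mem (IntermediateField.mem_adjoin_simple_self ℚ _) i

/-- The automorphism `σ_r` of `ℚ(ζₙ)`, for `r` coprime to `n`: see `sigma_apply` below. -/
noncomputable def sigma (n : ℕ) [NeZero n] (r : ℤ) (hr : IsCoprime r n) : CF n ≃ₐ[ℚ] CF n :=
  (IsCyclotomicExtension.autEquivPow (CF n)
    (Polynomial.cyclotomic.irreducible_rat (NeZero.pos n))).symm
    (ZMod.unitOfIsCoprime r hr)

/-- `σ_r` sends every `n`-th root of unity to its `r`-th power. -/
theorem sigma_apply (n : ℕ) [NeZero n] (r : ℤ) (hr : IsCoprime r n) (ζ : CF n) (hζ : ζ ^ n = 1) :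
    sigma n r hr ζ = ζ ^ r := by
  have hz := IsCyclotomicExtension.zeta_spec n ℚ (CF n)
  have h1 : sigma n r hr (IsCyclotomicExtension.zeta n ℚ (CF n)) =
      IsCyclotomicExtension.zeta n ℚ (CF n) ^ r := by
    have h2 := hz.autToPow_spec ℚ (sigma n r hr)
    have h3 : hz.autToPow ℚ (sigma n r hr) = ZMod.unitOfIsCoprime r hr :=
      MulEquiv.apply_symm_apply (IsCyclotomicExtension.autEquivPow (CF n)
        (Polynomial.cyclotomic.irreducible_rat (NeZero.pos n))) _
    rw [← h2, h3, ZMod.coe_unitOfIsCoprime, ← zpow_natCast]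
    have hd : (n : ℤ) ∣ (((r : ZMod n).val : ℕ) : ℤ) - r := by
      rw [← ZMod.intCast_zmod_eq_zero_iff_dvd _ n]
      simp
    obtain ⟨k, hk⟩ := hd
    rw [show (((r : ZMod n).val : ℕ) : ℤ) = r + n * k by linarith,
      zpow_add₀ (hz.ne_zero (NeZero.ne n)), zpow_mul, zpow_natCast, hz.pow_eq_one, one_zpow,
      mul_one]
  obtain ⟨i, -, rfl⟩ := hz.eq_pow_of_pow_eq_one hζ
  rw [map_pow, h1, ← zpow_natCast, ← zpow_natCast, ← zpow_mul, ← zpow_mul, mul_comm]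

end Cyclotomic

section Indicators

/-- The Adams operator `ψ^r`, `ψ^r(f)(x) = f(x ^ r)`. -/
def adams {H : Type*} [Group H] (r : ℤ) (f : H → ℂ) : H → ℂ := fun x => f (x ^ r)

variable {G : Type*} [Group G]

/-- The centralizer `C_G(g)` of an element. -/
abbrev C (g : G) : Subgroup G := Subgroup.centralizer {g}

theorem mem_C {g x : G} : x ∈ C g ↔ Commute x g := by
  rw [Subgroup.mem_centralizer_singleton_iff]
  rfl

/-- If `r` is coprime to the exponent of `G`, then `g` and `g ^ r` have the same centralizer. -/
theorem C_zpow {r : ℤ} (hr : IsCoprime r (Monoid.exponent G)) (g : G) : C g = C (g ^ r) := by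
  obtain ⟨a, b, hab⟩ := hr
  have hg : (g ^ r) ^ a = g := by
    rw [← zpow_mul, show r * a = 1 - b * Monoid.exponent G by linarith, zpow_sub, zpow_one,
      mul_comm b, zpow_mul, zpow_natCast, Monoid.pow_exponent_eq_one, one_zpow, inv_one, mul_one]
  ext x
  rw [mem_C, mem_C]
  refine ⟨fun h => h.zpow_right r, fun h => ?_⟩
  have := h.zpow_right a
  rwa [hg] at this

/-- An irreducible character of a subgroup `H`, viewed as one of `K` when `H = K`. -/
def Irr.transport {H K : Subgroup G} (h : H = K) (χ : Irr H) : Irr K := h ▸ χ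

theorem Irr.transport_apply {H K : Subgroup G} (h : H = K) (χ : Irr H) (x : G) (hx : x ∈ K) :
    (Irr.transport h χ).1 ⟨x, hx⟩ = χ.1 ⟨x, h ▸ hx⟩ := by
  subst h
  rfl

theorem zpow_mem_C {m : ℤ} {g x : G} (h : x ^ m = (g * x) ^ m) : x ^ m ∈ C g := by
  rw [mem_C]
  have h1 : Commute (x ^ m) x := (Commute.refl x).zpow_left m
  have h2 : Commute (x ^ m) (g * x) := h ▸ (Commute.refl (g * x)).zpow_left m
  simpa using h2.mul_right h1.inv_right

/-- The `m`-th Frobenius–Schur indicator of the module over the Drinfeld double of `G` attached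
to `g` and a character `η` of `C_G(g)`: `ν_m(g, η) = |C_G(g)|⁻¹ ∑ η(x ^ m)`, the sum being over
the `x ∈ G` with `x ^ m = (g x) ^ m`. -/
noncomputable def nu (m : ℤ) (g : G) (η : C g → ℂ) : ℂ :=
  (Nat.card (C g) : ℂ)⁻¹ * ∑ᶠ x : {x : G // x ^ m = (g * x) ^ m}, η ⟨x.1 ^ m, zpow_mem_C x.2⟩

/-- The set `G_m(g, z)` of those `x ∈ G` with `x ^ m = (g x) ^ m = z`. -/
def powSet (m : ℤ) (g z : G) : Set G := {x | x ^ m = z ∧ (g * x) ^ m = z}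

/-- The class function `γ_m^z : C_G(z) → ℂ`, `g ↦ |G_m(g, z)|`. -/
noncomputable def gam (m : ℤ) (z : G) : ClassFun (C z) where
  val g := (Nat.card (powSet m (g : G) z) : ℂ)
  property := by
    intro t g
    have ht : (t : G) * z = z * t := mem_C.1 t.2
    have key : ∀ y : G, ((t : G) * y * (t : G)⁻¹) ^ m = z ↔ y ^ m = z := by
      intro y
      rw [conj_zpow, mul_inv_eq_iff_eq_mul, ← ht, mul_left_cancel_iff]
    refine congrArg Nat.cast (Nat.card_congr ((MulAut.conj (t : G)).toEquiv.subtypeEquiv ?_).symm)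
    intro x
    refine and_congr (key x).symm ?_
    rw [← key ((g : G) * x)]
    simp [mul_assoc]

/-- The coefficients `β_m(z, χ)` in the expansion `γ_m^z = ∑ β_m(z, χ) χ` over the irreducible
characters `χ` of `C_G(z)`. -/
noncomputable def beta [Finite G] (m : ℤ) (z : G) (χ : Irr (C z)) : ℂ :=
  (irrBasis (C z)).repr (gam m z) χ

/-- `g` and `h` are rationally conjugate, i.e. lie in the same rational conjugacy class: `h` is
conjugate to `g ^ r` for some `r` coprime to the order of `g`. -/
def IsRatConj (g h : G) : Prop :=
  ∃ r : ℤ, IsCoprime r (orderOf g) ∧ IsConj (g ^ r) h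

end Indicators

end DoubleIndicator

open DoubleIndicator

namespace DoubleIndicator

/-! ### Extending Galois automorphisms of the cyclotomic field to `ℂ`. -/

section Cyclotomic

/-! Grouping terms by `x ^ m = z` makes both invariants averages of character values with weights
`N(g, z) = |powSet m g z|`: `ν_m(g, η)` averages `N(g, z) η(z)` over `z ∈ C g`, and `β_m(z, χ)`
averages `N(g, z) χ(g⁻¹)` over `g ∈ C z` (`nu_eq_sum`, `beta_eq_sum`). The weights are integers and
`σ_r` sends `χ(x)` to `χ(x ^ r)` (`Irr.map_apply`), so the Galois action on the averages is `ψ^r` on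
the character.

Replacing `g` (or `z`) by its `r`-th power has the same effect once `N(g ^ r, z ^ r) = N(g, z)` for
commuting `g`, `z` (`card_powSet_zpow`), since `x ↦ x ^ r` permutes the centralizer. That equality
is the crux. `N` is a convolution of indicator class functions on `C z`, and convolution commutes
with `ψ^r` (`sum_zpow_mul_zpow`): convolving with an irreducible character is scalar multiplication
by Schur, `ψ^r` preserves irreducibility, and the scalars agree at the identity. -/

theorem mem_CF_of_pow_eq_one {n : ℕ} {ζ : ℂ} (h : ζ ^ n = 1) : ζ ∈ CF n :=
  IntermediateField.subset_adjoin _ _ h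

/-- A ring automorphism of a subfield of `ℂ` extends to `ℂ`. -/
theorem exists_ringEquiv_extends {F : Type*} [Field F] [Algebra F ℂ] (σ : F ≃+* F) :
    ∃ τ : ℂ ≃+* ℂ, ∀ x : F, τ (algebraMap F ℂ x) = algebraMap F ℂ (σ x) := by
  -- `ℂ` is an algebraic closure of the polynomial ring `F[s]`; let `σ` act on the coefficients,
  -- then lift to the closure.
  obtain ⟨s, hs⟩ := exists_isTranscendenceBasis F ℂ
  let A := Algebra.adjoin F (Set.range ((↑) : s → ℂ))
  have : IsAlgClosure A ℂ := IsAlgClosed.isAlgClosure_of_transcendence_basis _ hs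
  let e : MvPolynomial s F ≃ₐ[F] A := hs.1.aevalEquiv
  let φ : A ≃+* A :=
    (e.symm.toRingEquiv.trans (MvPolynomial.mapEquiv s σ)).trans e.toRingEquiv
  refine ⟨IsAlgClosure.equivOfEquiv ℂ ℂ φ, fun x => ?_⟩
  have h := IsAlgClosure.equivOfEquiv_algebraMap ℂ ℂ φ (algebraMap F A x)
  rw [← IsScalarTower.algebraMap_apply F A ℂ] at h
  rw [h, IsScalarTower.algebraMap_apply F A ℂ]
  congr 1
  have : e.symm (algebraMap F A x) = MvPolynomial.C x := e.symm.commutes x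
  simp only [φ, RingEquiv.trans_apply, AlgEquiv.coe_ringEquiv, this,
    MvPolynomial.mapEquiv_apply, MvPolynomial.map_C]
  exact e.commutes _

/-- `σ_r` extends to an automorphism of `ℂ`. -/
theorem exists_ringEquiv_extends_sigma (n : ℕ) [NeZero n] (r : ℤ) (hr : IsCoprime r n) :
    ∃ τ : ℂ ≃+* ℂ, (∀ x : CF n, τ x = sigma n r hr x) ∧ ∀ ζ : ℂ, ζ ^ n = 1 → τ ζ = ζ ^ r := by
  obtain ⟨τ, hτ⟩ := exists_ringEquiv_extends (sigma n r hr).toRingEquiv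
  refine ⟨τ, hτ, fun ζ hζ => ?_⟩
  have h := sigma_apply n r hr ⟨ζ, mem_CF_of_pow_eq_one hζ⟩ (Subtype.ext (by simpa using hζ))
  exact (hτ ⟨ζ, mem_CF_of_pow_eq_one hζ⟩).trans (congrArg Subtype.val h)

end Cyclotomic

/-! ### Galois action on character values, and operations preserving irreducibility. -/

section CharacterValues

variable {H : Type*} [Group H]

/-- An endomorphism of finite order is diagonalizable with roots of unity as eigenvalues, which
gives the traces of all its powers. -/
theorem trace_pow_of_pow_eq_one {V : Type*} [AddCommGroup V] [Module ℂ V] [FiniteDimensional ℂ V]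
    {n : ℕ} (hn : n ≠ 0) (f : Module.End ℂ V) (hf : f ^ n = 1) :
    ∃ (S : Finset ℂ) (d : ℂ → ℕ), (∀ ζ ∈ S, ζ ^ n = 1) ∧
      ∀ k : ℕ, LinearMap.trace ℂ V (f ^ k) = ∑ ζ ∈ S, d ζ * ζ ^ k := by
  have hss : f.IsSemisimple := by
    refine Module.End.isSemisimple_of_squarefree_aeval_eq_zero
      (p := Polynomial.X ^ n - Polynomial.C 1) ?_ (by simp [hf])
    exact (Polynomial.separable_X_pow_sub_C (1 : ℂ) (by simpa) one_ne_zero).squarefree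
  have hint : DirectSum.IsInternal f.eigenspace :=
    (DirectSum.isInternal_submodule_iff_iSupIndep_and_iSup_eq_top _).2
      ⟨f.eigenspaces_iSupIndep, hss.iSup_eigenspace_eq_top⟩
  have hfin : {ζ | f.eigenspace ζ ≠ ⊥}.Finite :=
    WellFoundedGT.finite_ne_bot_of_iSupIndep f.eigenspaces_iSupIndep
  have hpow : ∀ (k : ℕ) (ζ : ℂ), ∀ v ∈ f.eigenspace ζ, (f ^ k) v = ζ ^ k • v := by
    intro k ζ v hv
    rw [Module.End.mem_eigenspace_iff] at hv
    induction k with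
    | zero => simp
    | succ k ih => rw [pow_succ', Module.End.mul_apply, ih, map_smul, hv, smul_smul, pow_succ]
  refine ⟨hfin.toFinset, fun ζ => Module.finrank ℂ (f.eigenspace ζ), fun ζ hζ => ?_, fun k => ?_⟩
  · obtain ⟨v, hv, hv0⟩ := Submodule.exists_mem_ne_zero_of_ne_bot (hfin.mem_toFinset.1 hζ)
    have h := hpow n ζ v hv
    rw [hf, Module.End.one_apply] at h
    refine smul_left_injective ℂ hv0 ?_
    simpa using h.symm
  · have hmaps : ∀ ζ, Set.MapsTo (f ^ k) (f.eigenspace ζ) (f.eigenspace ζ) := fun ζ v hv => by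
      rw [hpow k ζ v hv]
      exact Submodule.smul_mem _ _ hv
    rw [LinearMap.trace_eq_sum_trace_restrict' hint hfin hmaps]
    refine Finset.sum_congr rfl fun ζ _ => ?_
    have : (f ^ k).restrict (hmaps ζ) = ζ ^ k • LinearMap.id := by
      ext v
      exact hpow k ζ v v.2
    rw [this, map_smul, LinearMap.trace_id, smul_eq_mul, mul_comm]

/-- The eigenvalues and multiplicities of `ρ x` serve for all `r` at once, so `r = 1` can be
compared with any other exponent. Negative exponents reduce to natural ones modulo `n`. -/
theorem Irr.apply_zpow {n : ℕ} (hn : n ≠ 0) (χ : Irr H) (x : H) (hx : x ^ n = 1) :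
    ∃ (S : Finset ℂ) (d : ℂ → ℕ), (∀ ζ ∈ S, ζ ^ n = 1) ∧
      ∀ r : ℤ, χ.1 (x ^ r) = ∑ ζ ∈ S, d ζ * ζ ^ r := by
  obtain ⟨χ, l, ρ, -, rfl⟩ := χ
  obtain ⟨S, d, hS, hd⟩ := trace_pow_of_pow_eq_one hn (ρ x) (by rw [← map_pow, hx, map_one])
  refine ⟨S, d, hS, fun r => ?_⟩
  have hn' : (n : ℤ) ≠ 0 := by exact_mod_cast hn
  obtain ⟨k, hk⟩ := Int.eq_ofNat_of_zero_le (Int.emod_nonneg r hn')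
  have hr : r = n * (r / n) + (k : ℤ) := by rw [← hk, Int.mul_ediv_add_emod]
  have hH : x ^ r = x ^ k := by
    rw [hr, zpow_add, zpow_mul, zpow_natCast, hx, one_zpow, one_mul, zpow_natCast]
  have hC : ∀ ζ ∈ S, ζ ^ r = ζ ^ k := fun ζ hζ => by
    have h0 : ζ ≠ 0 := fun h => by simpa [h, hn] using hS ζ hζ
    rw [hr, zpow_add₀ h0, zpow_mul, zpow_natCast, hS ζ hζ, one_zpow, one_mul, zpow_natCast]
  change LinearMap.trace ℂ _ (ρ (x ^ r)) = _
  rw [hH, map_pow, hd k]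
  exact Finset.sum_congr rfl fun ζ hζ => by rw [hC ζ hζ]

theorem Irr.apply_mem_CF {n : ℕ} (hn : n ≠ 0) (χ : Irr H) (x : H) (hx : x ^ n = 1) :
    χ.1 x ∈ CF n := by
  obtain ⟨S, d, hS, hd⟩ := Irr.apply_zpow hn χ x hx
  rw [← zpow_one x, hd]
  exact sum_mem fun ζ hζ => mul_mem (natCast_mem _ _)
    (zpow_mem (mem_CF_of_pow_eq_one (hS ζ hζ)) _)

theorem Irr.map_apply {n : ℕ} (hn : n ≠ 0) (χ : Irr H) (x : H) (hx : x ^ n = 1) {r : ℤ}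
    (τ : ℂ ≃+* ℂ) (hτ : ∀ ζ : ℂ, ζ ^ n = 1 → τ ζ = ζ ^ r) : τ (χ.1 x) = χ.1 (x ^ r) := by
  obtain ⟨S, d, hS, hd⟩ := Irr.apply_zpow hn χ x hx
  have h1 := hd 1
  rw [zpow_one] at h1
  rw [h1, hd r, map_sum]
  refine Finset.sum_congr rfl fun ζ hζ => ?_
  rw [map_mul, map_natCast, zpow_one, hτ ζ (hS ζ hζ)]

/-- Irreducibility is preserved by semilinear isomorphisms. -/
theorem isIrreducible_of_semilinear {H' V V' : Type*} [Group H'] [AddCommGroup V] [Module ℂ V]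
    [AddCommGroup V'] [Module ℂ V'] {ρ : Representation ℂ H V} {ρ' : Representation ℂ H' V'}
    (τ : ℂ ≃+* ℂ) (e : H → H') (s : V ≃+ V') (hs : ∀ (c : ℂ) v, s (c • v) = τ c • s v)
    (hρ : ∀ x v, s (ρ x v) = ρ' (e x) (s v)) (h : ρ.IsIrreducible) : ρ'.IsIrreducible := by
  -- The preimage under `s` is a complex subspace because `s` is semilinear. Stability needs only
  -- the operators `ρ' (e x)`, so `e` may be any map.
  let pull (W : Subrepresentation ρ') : Subrepresentation ρ :=
    { toSubmodule :=
        { W.toSubmodule.toAddSubmonoid.comap s.toAddMonoidHom with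
          smul_mem' := fun c v hv => by
            change s (c • v) ∈ W.toSubmodule
            rw [hs]
            exact W.toSubmodule.smul_mem _ hv }
      apply_mem_toSubmodule := fun x v hv => by
        change s (ρ x v) ∈ W.toSubmodule
        rw [hρ]
        exact W.apply_mem_toSubmodule _ hv }
  have hpull : ∀ W v, v ∈ (pull W).toSubmodule ↔ s v ∈ W.toSubmodule := fun _ _ => Iff.rfl
  have hbot : ∀ v, v ∈ (⊥ : Subrepresentation ρ).toSubmodule ↔ v = 0 := fun _ => Iff.rfl
  have hbot' : ∀ v, v ∈ (⊥ : Subrepresentation ρ').toSubmodule ↔ v = 0 := fun _ => Iff.rfl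
  have htop : ∀ v, v ∈ (⊤ : Subrepresentation ρ).toSubmodule := fun _ => trivial
  have htop' : ∀ v, v ∈ (⊤ : Subrepresentation ρ').toSubmodule := fun _ => trivial
  have : Nontrivial (Subrepresentation ρ') := by
    refine ⟨⊥, ⊤, fun h0 => bot_ne_top (α := Subrepresentation ρ) ?_⟩
    refine Subrepresentation.toSubmodule_injective (Submodule.ext fun v => ?_)
    have := htop' (s v)
    rw [← h0, hbot', map_eq_zero_iff s s.injective] at this
    exact ⟨fun _ => htop v, fun _ => (hbot v).2 this⟩
  refine ⟨fun W => (eq_bot_or_eq_top (pull W)).imp (fun h0 => ?_) fun h0 => ?_⟩ <;>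
    refine Subrepresentation.toSubmodule_injective (Submodule.ext fun v => ?_) <;>
    rw [← s.apply_symm_apply v, ← hpull, h0]
  · rw [hbot, hbot', map_eq_zero_iff s s.injective]
  · exact ⟨fun _ => htop' _, fun _ => htop _⟩

/-- The composition of an irreducible character with an automorphism of `ℂ` is an irreducible
character. -/
theorem Irr.map_mem (χ : Irr H) (τ : ℂ ≃+* ℂ) : (fun x => τ (χ.1 x)) ∈ Irr H := by
  obtain ⟨χ, l, ρ, hρ, rfl⟩ := χ
  -- `φ` applies `τ` to matrix entries; the coordinatewise `τ`, called `s`, intertwines `ρ` with `φ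
  -- ∘ ρ` semilinearly.
  let φ : Module.End ℂ (Fin l → ℂ) →* Module.End ℂ (Fin l → ℂ) :=
    (Matrix.toLinAlgEquiv' (R := ℂ) (n := Fin l)).toMonoidHom.comp
      ((τ.toRingHom.mapMatrix).toMonoidHom.comp
        (LinearMap.toMatrixAlgEquiv' (R := ℂ) (n := Fin l)).toMonoidHom)
  have hφ : ∀ f, φ f = Matrix.toLin' ((LinearMap.toMatrix' f).map τ) := fun _ => rfl
  let s : (Fin l → ℂ) ≃+ (Fin l → ℂ) := AddEquiv.piCongrRight fun _ => τ.toAddEquiv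
  have hs : ∀ v i, s v i = τ (v i) := fun _ _ => rfl
  refine ⟨l, φ.comp ρ, ?_, ?_⟩
  · refine isIrreducible_of_semilinear τ id s (fun c v => ?_) (fun x v => ?_) hρ
    · ext i
      simp [hs]
    · ext i
      have hv : ρ x v = (LinearMap.toMatrix' (ρ x)).mulVec v := by
        rw [← Matrix.toLin'_apply, Matrix.toLin'_toMatrix']
      rw [hs, hv, MonoidHom.comp_apply, hφ, Matrix.toLin'_apply]
      simp [Matrix.mulVec, dotProduct, map_sum, hs]
  · ext x
    change LinearMap.trace ℂ _ (φ (ρ x)) = τ (LinearMap.trace ℂ _ (ρ x))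
    rw [hφ, ← Matrix.toLin'_toMatrix' (ρ x), Matrix.trace_toLin'_eq, Matrix.trace_toLin'_eq,
      LinearMap.toMatrix'_toLin', Matrix.trace, Matrix.trace]
    simp [map_sum]

/-- The Adams operators of degree coprime to the exponent preserve irreducible characters. -/
theorem Irr.adams_mem {n : ℕ} [NeZero n] (hH : ∀ x : H, x ^ n = 1) {r : ℤ} (hr : IsCoprime r n)
    (χ : Irr H) : adams r χ.1 ∈ Irr H := by
  obtain ⟨τ, -, hτ⟩ := exists_ringEquiv_extends_sigma n r hr
  convert Irr.map_mem χ τ using 1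
  ext x
  exact (Irr.map_apply (NeZero.ne n) χ x (hH x) τ hτ).symm

/-- The pullback of an irreducible character along an isomorphism is irreducible. -/
theorem Irr.comp_mem {H' : Type*} [Group H'] (e : H' ≃* H) (χ : Irr H) :
    (fun x => χ.1 (e x)) ∈ Irr H' := by
  obtain ⟨χ, l, ρ, hρ, rfl⟩ := χ
  refine ⟨l, ρ.comp e.toMonoidHom, ?_, rfl⟩
  refine isIrreducible_of_semilinear (RingEquiv.refl ℂ) e.symm (AddEquiv.refl _) (fun _ _ => rfl)
    (fun x v => ?_) hρ
  simp

theorem Irr.apply_one_ne_zero (χ : Irr H) : χ.1 1 ≠ 0 := by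
  obtain ⟨χ, l, ρ, hρ, rfl⟩ := χ
  have : Nontrivial (Fin l → ℂ) := by
    by_contra h
    rw [not_nontrivial_iff_subsingleton] at h
    exact bot_ne_top (α := Subrepresentation ρ) (Subrepresentation.toSubmodule_injective
      (Subsingleton.elim _ _))
  change ρ.character 1 ≠ 0
  rw [Representation.char_one]
  exact_mod_cast (Module.finrank_pos (R := ℂ) (M := Fin l → ℂ)).ne'

end CharacterValues
-- Convolution of class functions and Adams operators.
section Convolution

variable {H : Type*} [Group H] [Fintype H]

/-- By Schur's lemma, convolving an irreducible character with a class function multiplies it by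
a scalar. -/
theorem Irr.exists_sum_mul_eq (f : ClassFun H) (χ : Irr H) :
    ∃ c : ℂ, ∀ g : H, ∑ x : H, f.1 x * χ.1 (g * x) = c * χ.1 g := by
  obtain ⟨χ, l, ρ, hρ, rfl⟩ := χ
  let T : Module.End ℂ (Fin l → ℂ) := ∑ x : H, f.1 x • ρ x
  have hT : ∀ g, ρ g * T = T * ρ g := by
    intro g
    simp only [T, Finset.mul_sum, Finset.sum_mul, mul_smul_comm, smul_mul_assoc, ← map_mul]
    refine Fintype.sum_equiv (MulAut.conj g).toEquiv _ _ fun x => ?_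
    have := f.2 g x
    simp [this]
  let φ : Representation.IntertwiningMap ρ ρ :=
    { T with isIntertwining' := fun g => (hT g).symm }
  obtain ⟨c, hc⟩ :=
    (Representation.IsIrreducible.algebraMap_intertwiningMap_bijective_of_isAlgClosed
      (ρ := ρ)).2 φ
  have hTc : T = c • 1 := by
    have := congrArg Representation.IntertwiningMap.toLinearMap hc
    exact this.symm
  refine ⟨c, fun g => ?_⟩
  have h1 : LinearMap.trace ℂ _ (ρ g * T) = ∑ x : H, f.1 x * ρ.character (g * x) := by
    simp only [T, Finset.mul_sum, mul_smul_comm, ← map_mul, map_sum, map_smul, smul_eq_mul]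
    rfl
  have h2 : LinearMap.trace ℂ _ (ρ g * T) = c * ρ.character g := by
    rw [hTc, mul_smul_comm, mul_one, map_smul, smul_eq_mul]
    rfl
  exact h1.symm.trans h2

/-- The `r`-th power map of a finite group is bijective for `r` coprime to the exponent. -/
theorem zpow_bijective {H : Type*} [Group H] {n : ℕ} (hH : ∀ x : H, x ^ n = 1) {r : ℤ}
    (hr : IsCoprime r n) : Function.Bijective fun x : H => x ^ r := by
  obtain ⟨a, b, hab⟩ := hr
  have h : ∀ x : H, x ^ (a * r) = x := fun x => by
    rw [show a * r = 1 - n * b by linarith, zpow_sub, zpow_mul, zpow_natCast, hH, one_zpow,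
      zpow_one, inv_one, mul_one]
  refine Function.bijective_iff_has_inverse.2 ⟨fun x => x ^ a, fun x => ?_, fun x => ?_⟩
  · simp only [← zpow_mul, mul_comm r, h]
  · simp only [← zpow_mul, h]

/-- The convolution of class functions commutes with the Adams operators of degree coprime to the
exponent. -/
theorem sum_zpow_mul_zpow {n : ℕ} [NeZero n] (hH : ∀ x : H, x ^ n = 1) {r : ℤ}
    (hr : IsCoprime r n) (f h : ClassFun H) (g : H) :
    ∑ x : H, f.1 (x ^ r) * h.1 ((g * x) ^ r) = ∑ x : H, f.1 x * h.1 (g ^ r * x) := by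
  -- Both sides are linear in `h`, so `h` may be taken irreducible.
  have hh : h ∈ Submodule.span ℂ (Set.range (Irr.toClassFun : Irr H → ClassFun H)) :=
    irr_span trivial
  induction hh using Submodule.span_induction with
  | zero => simp
  | add h₁ h₂ _ _ ih₁ ih₂ => simp [mul_add, Finset.sum_add_distrib, ih₁, ih₂]
  | smul c h _ ih => simp [mul_left_comm, ← Finset.mul_sum, ih]
  | mem h hh =>
    obtain ⟨χ, rfl⟩ := hh
    let fr : ClassFun H := ⟨adams r f.1, fun t x => by simp [adams, conj_zpow, f.2 t]⟩
    obtain ⟨c, hc⟩ := Irr.exists_sum_mul_eq f χ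
    obtain ⟨c', hc'⟩ := Irr.exists_sum_mul_eq fr ⟨_, Irr.adams_mem hH hr χ⟩
    -- At `g = 1` the two convolutions differ only by the reindexing `x ↦ x ^ r`, which forces the
    -- Schur scalars to coincide.
    have h1 : c' * χ.1 1 = c * χ.1 1 := by
      have := hc' 1
      simp only [adams, one_zpow, one_mul, fr] at this
      rw [← this, ← hc 1]
      simpa using (zpow_bijective hH hr).sum_comp fun x => f.1 x * χ.1 x
    rw [mul_right_cancel₀ (Irr.apply_one_ne_zero χ) h1] at hc'
    exact (hc' g).trans (hc (g ^ r)).symm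

end Convolution

/-! ### Counting common `m`-th roots, and the resulting formulas for `ν` and `β`. -/

section Indicators

variable {G : Type*} [Group G]

/-- Presents the count as a convolution on `D`. Leaving `D` free allows `D = C z` for both `w = z`
and `w = z ^ r`. -/
theorem card_powSet [Finite G] {m : ℤ} {D : Subgroup G} [Fintype D] {w : G} [DecidableEq G]
    (hD : ∀ x : G, x ^ m = w → x ∈ D) (g : D) :
    (Nat.card (powSet m (g : G) w) : ℂ) =
      ∑ x : D, (if (x : G) ^ m = w then 1 else 0) * if ((g * x : D) : G) ^ m = w then 1 else 0 := by
  have e : powSet m (g : G) w ≃ {x : D // (x : G) ^ m = w ∧ ((g * x : D) : G) ^ m = w} :=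
    { toFun := fun x => ⟨⟨x.1, hD _ x.2.1⟩, x.2⟩
      invFun := fun x => ⟨x.1.1, x.2⟩
      left_inv := fun _ => rfl
      right_inv := fun _ => rfl }
  rw [Nat.card_congr e, Nat.card_eq_fintype_card, Fintype.card_subtype]
  simp [← ite_and, Finset.sum_boole, and_comm]

theorem mem_C_of_zpow_eq {m : ℤ} {x z : G} (h : x ^ m = z) : x ∈ C z :=
  mem_C.2 (h ▸ (Commute.refl x).zpow_right m)

/-- `|G_m(g ^ r, z ^ r)| = |G_m(g, z)|` for `r` coprime to the exponent. -/
theorem card_powSet_zpow [Finite G] {m r : ℤ} (hr : IsCoprime r (Monoid.exponent G)) (z : G)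
    (g : C z) : Nat.card (powSet m ((g : G) ^ r) (z ^ r)) = Nat.card (powSet m (g : G) z) := by
  classical
  have := Fintype.ofFinite (C z)
  have hG : ∀ x : G, x ^ Monoid.exponent G = 1 := Monoid.pow_exponent_eq_one
  have hH : ∀ x : C z, x ^ Monoid.exponent G = 1 := fun x => Subtype.ext (by simp [hG])
  have hzr : ∀ t : C z, (t : G) * z ^ r = z ^ r * t := fun t =>
    (Commute.zpow_right (mem_C.1 t.2) r)
  -- The indicator is of the roots of `z ^ r`; by injectivity of the power map, `ψ^r f` is then the
  -- indicator of the roots of `z`.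
  let f : ClassFun (C z) := ⟨fun x => if (x : G) ^ m = z ^ r then 1 else 0, fun t x => by
    refine if_congr ?_ rfl rfl
    rw [Subgroup.coe_mul, Subgroup.coe_mul, Subgroup.coe_inv, conj_zpow, mul_inv_eq_iff_eq_mul, ← hzr, mul_left_cancel_iff]⟩
  have hf : ∀ x : C z, f.1 (x ^ r) = if (x : G) ^ m = z then 1 else 0 := fun x => by
    change (if ((x ^ r : C z) : G) ^ m = z ^ r then (1 : ℂ) else 0) = _
    congr 1
    rw [Subgroup.coe_zpow, ← zpow_mul, mul_comm, zpow_mul, (zpow_bijective hG hr).1.eq_iff]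
  have h1 := card_powSet (fun x (hx : x ^ m = z) => mem_C_of_zpow_eq hx) g
  have h2 := card_powSet (D := C z) (m := m) (w := z ^ r) (fun x hx => by
    rw [C_zpow hr]; exact mem_C_of_zpow_eq hx) (g ^ r)
  have h3 := sum_zpow_mul_zpow hH hr f f g
  simp only [hf] at h3
  rw [← h1] at h3
  exact_mod_cast (h2.trans h3.symm)

/-- The indicator as a sum over the centralizer. -/
theorem nu_eq_sum [Finite G] (m : ℤ) (g : G) (η : C g → ℂ) [Fintype (C g)] :
    nu m g η = (Nat.card (C g) : ℂ)⁻¹ * ∑ z : C g, Nat.card (powSet m g z) * η z := by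
  classical
  have := Fintype.ofFinite {x : G // x ^ m = (g * x) ^ m}
  rw [nu, finsum_eq_sum_of_fintype]
  congr 1
  rw [← Finset.sum_fiberwise Finset.univ
    (fun x : {x : G // x ^ m = (g * x) ^ m} => (⟨x.1 ^ m, zpow_mem_C x.2⟩ : C g))]
  refine Finset.sum_congr rfl fun z _ => ?_
  rw [Finset.sum_congr rfl (g := fun _ => η z) fun x hx => by rw [(Finset.mem_filter.1 hx).2],
    Finset.sum_const, nsmul_eq_mul]
  congr 2
  rw [← Fintype.card_subtype, ← Nat.card_eq_fintype_card]
  refine Nat.card_congr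
    { toFun := fun x => ⟨x.1.1, congrArg Subtype.val x.2, ?_⟩
      invFun := fun x => ⟨⟨x.1, x.2.1.trans x.2.2.symm⟩, Subtype.ext x.2.1⟩
      left_inv := fun _ => rfl
      right_inv := fun _ => rfl }
  exact x.1.2.symm.trans (congrArg Subtype.val x.2)

/-- With `D` a variable the transport can be eliminated; it is applied to `D = C g` and the element
`g ^ r`. -/
theorem nu_eq_sum_of_eq [Finite G] (m : ℤ) (g : G) (D : Subgroup G) (hD : D = C g) (η : Irr D)
    [Fintype D] : nu m g (Irr.transport hD η).1 =
      (Nat.card D : ℂ)⁻¹ * ∑ z : D, Nat.card (powSet m g z) * η.1 z := by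
  subst hD
  exact nu_eq_sum m g η.1

theorem beta_eq_sum [Finite G] (m : ℤ) (z : G) (χ : Irr (C z)) [Fintype (C z)] :
    beta m z χ =
      (Nat.card (C z) : ℂ)⁻¹ * ∑ g : C z, Nat.card (powSet m (g : G) z) * χ.1 g⁻¹ := by
  classical
  -- Orthonormality identifies the coordinate functional with the pairing on basis vectors.
  have h : (irrBasis (C z)).coord χ = pairing χ := by
    refine (irrBasis (C z)).ext fun ψ => ?_
    rw [Module.Basis.coord_apply, Module.Basis.repr_self, Finsupp.single_apply, irrBasis,
      Module.Basis.mk_apply]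
    simp only [@eq_comm _ ψ]
    exact (irr_orthonormal χ ψ).symm
  exact LinearMap.congr_fun h (gam m z)

theorem beta_eq_sum_of_eq [Finite G] (m : ℤ) (z : G) (D : Subgroup G) (hD : D = C z) (χ : Irr D)
    [Fintype D] : beta m z (Irr.transport hD χ) =
      (Nat.card D : ℂ)⁻¹ * ∑ g : D, Nat.card (powSet m (g : G) z) * χ.1 g⁻¹ := by
  subst hD
  exact beta_eq_sum m z χ

theorem pow_exponent_eq_one_subgroup (D : Subgroup G) (x : D) : x ^ Monoid.exponent G = 1 :=
  Subtype.ext (by simp [Monoid.pow_exponent_eq_one])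

theorem nu_zpow [Finite G] (m : ℤ) {r : ℤ} (hr : IsCoprime r (Monoid.exponent G)) (g : G)
    (η : Irr (C g)) : nu m (g ^ r) (Irr.transport (C_zpow hr g) η).1 = nu m g (adams r η.1) := by
  have := Fintype.ofFinite (C g)
  rw [nu_eq_sum_of_eq, nu_eq_sum,
    ← (zpow_bijective (pow_exponent_eq_one_subgroup (C g)) hr).sum_comp]
  congr 1
  refine Finset.sum_congr rfl fun z _ => ?_
  rw [Subgroup.coe_zpow, card_powSet_zpow hr (z : G) ⟨g, mem_C.2 (mem_C.1 z.2).symm⟩]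
  rfl

theorem beta_zpow [Finite G] (m : ℤ) {r : ℤ} (hr : IsCoprime r (Monoid.exponent G)) (z : G)
    (χ χr : Irr (C z)) (h : χr.1 = adams r χ.1) :
    beta m (z ^ r) (Irr.transport (C_zpow hr z) χ) = beta m z χr := by
  have := Fintype.ofFinite (C z)
  rw [beta_eq_sum_of_eq, beta_eq_sum,
    ← (zpow_bijective (pow_exponent_eq_one_subgroup (C z)) hr).sum_comp]
  congr 1
  refine Finset.sum_congr rfl fun g _ => ?_
  rw [Subgroup.coe_zpow, card_powSet_zpow hr z g, h, adams, inv_zpow]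

/-- The map `u` is the identity for `ν` and inversion for `β`. -/
theorem sum_natCast_mul_mem_CF {H : Type*} [Group H] [Fintype H] {n : ℕ} (hn : n ≠ 0)
    (hH : ∀ x : H, x ^ n = 1) (k : ℕ) (a : H → ℕ) (u : H → H) (χ : Irr H) :
    (k : ℂ)⁻¹ * ∑ x, a x * χ.1 (u x) ∈ CF n :=
  mul_mem (inv_mem (natCast_mem _ _)) (sum_mem fun x _ =>
    mul_mem (natCast_mem _ _) (Irr.apply_mem_CF hn χ _ (hH (u x))))

theorem map_sum_natCast_mul {H : Type*} [Group H] [Fintype H] {n : ℕ} (hn : n ≠ 0)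
    (hH : ∀ x : H, x ^ n = 1) (k : ℕ) (a : H → ℕ) (u : H → H) (χ : Irr H) {r : ℤ}
    (τ : ℂ ≃+* ℂ) (hτ : ∀ ζ : ℂ, ζ ^ n = 1 → τ ζ = ζ ^ r) :
    τ ((k : ℂ)⁻¹ * ∑ x, a x * χ.1 (u x)) = (k : ℂ)⁻¹ * ∑ x, a x * χ.1 (u x ^ r) := by
  rw [map_mul, map_inv₀, map_natCast, map_sum]
  congr 1
  refine Finset.sum_congr rfl fun x _ => ?_
  rw [map_mul, map_natCast, Irr.map_apply hn χ _ (hH (u x)) τ hτ]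

/-! ### Invariance under automorphisms and rational conjugacy. -/

theorem exists_zpow_eq_of_coprime_orderOf [Finite G] {g : G} {r : ℤ}
    (hr : IsCoprime r (orderOf g)) :
    ∃ s : ℤ, IsCoprime s (Monoid.exponent G) ∧ g ^ s = g ^ r := by
  have : NeZero (Monoid.exponent G) := ⟨Monoid.exponent_ne_zero_of_finite⟩
  obtain ⟨u, hu⟩ := ZMod.unitsMap_surjective (Monoid.order_dvd_exponent g)
    (ZMod.unitOfIsCoprime r hr)
  refine ⟨(u : ZMod (Monoid.exponent G)).val,
    Nat.isCoprime_iff_coprime.2 (ZMod.val_coe_unit_coprime u), ?_⟩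
  have h := congrArg Units.val hu
  rw [ZMod.unitsMap_val, ZMod.coe_unitOfIsCoprime, ZMod.cast_eq_val] at h
  rw [zpow_eq_zpow_iff_modEq, ← ZMod.intCast_eq_intCast_iff]
  exact_mod_cast h

/-- The isomorphism of centralizers induced by an automorphism. -/
def centralizerEquiv (φ : G ≃* G) (g : G) : C g ≃* C (φ g) :=
  { φ.toEquiv.subtypeEquiv fun x => by
      rw [mem_C, mem_C]
      exact (commute_map_iff φ.injective).symm with
    map_mul' := fun x y => Subtype.ext (map_mul φ x.1 y.1) }

theorem card_powSet_map (φ : G ≃* G) (m : ℤ) (g z : G) :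
    Nat.card (powSet m (φ g) (φ z)) = Nat.card (powSet m g z) := by
  refine (Nat.card_congr (φ.toEquiv.subtypeEquiv fun x => ?_)).symm
  change x ^ m = z ∧ (g * x) ^ m = z ↔ φ x ^ m = φ z ∧ (φ g * φ x) ^ m = φ z
  rw [← map_mul, ← map_zpow, ← map_zpow, φ.injective.eq_iff, φ.injective.eq_iff]

theorem nu_map [Finite G] (φ : G ≃* G) (m : ℤ) (g : G) (η : C (φ g) → ℂ) :
    nu m g (fun x => η (centralizerEquiv φ g x)) = nu m (φ g) η := by
  have := Fintype.ofFinite (C g)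
  have := Fintype.ofFinite (C (φ g))
  rw [nu_eq_sum, nu_eq_sum, Nat.card_congr (centralizerEquiv φ g).toEquiv]
  congr 1
  refine Fintype.sum_equiv (centralizerEquiv φ g).toEquiv _ _ fun z => ?_
  rw [← card_powSet_map φ]
  rfl

theorem beta_map [Finite G] (φ : G ≃* G) (m : ℤ) (z : G) (χ : Irr (C (φ z))) :
    beta m z ⟨_, Irr.comp_mem (centralizerEquiv φ z) χ⟩ = beta m (φ z) χ := by
  have := Fintype.ofFinite (C z)
  have := Fintype.ofFinite (C (φ z))
  rw [beta_eq_sum, beta_eq_sum, Nat.card_congr (centralizerEquiv φ z).toEquiv]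
  congr 1
  refine Fintype.sum_equiv (centralizerEquiv φ z).toEquiv _ _ fun g => ?_
  rw [← card_powSet_map φ]
  simp only [MulEquiv.toEquiv_eq_coe, MulEquiv.coe_toEquiv, map_inv]
  rfl

/-- A Bézout inverse of `r` modulo the order undoes the power. Symmetry turns the one-sided
inclusions of `eq_of_isRatConj` into equalities. -/
theorem isRatConj_symm {g g' : G} (h : IsRatConj g g') : IsRatConj g' g := by
  obtain ⟨r, hr, hc⟩ := h
  obtain ⟨a, b, hab⟩ := hr
  have hg : (g ^ r) ^ a = g := by
    rw [← zpow_mul, show r * a = 1 - orderOf g * b by linarith, zpow_sub, zpow_mul, zpow_natCast,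
      pow_orderOf_eq_one, one_zpow, zpow_one, inv_one, mul_one]
  have hd : ∀ (x : G) (k : ℤ), orderOf (x ^ k) ∣ orderOf x := fun x k =>
    orderOf_dvd_of_pow_eq_one (by
      rw [← zpow_natCast, ← zpow_mul, mul_comm, zpow_mul, zpow_natCast, pow_orderOf_eq_one,
        one_zpow])
  obtain ⟨c, hc'⟩ := isConj_iff.1 hc
  have ho : orderOf g' = orderOf g := by
    rw [← hc', ← MulAut.conj_apply, MulEquiv.orderOf_eq]
    refine Nat.dvd_antisymm (hd _ r) ?_
    conv_lhs => rw [← hg]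
    exact hd _ a
  refine ⟨a, ⟨r, b, ?_⟩, isConj_iff.2 ⟨c⁻¹, ?_⟩⟩
  · rw [ho, mul_comm, hab]
  · rw [← hc', conj_zpow, hg]
    group

/-- A family of sets attached to the elements of a finite group is constant on rational conjugacy
classes if it can only shrink under automorphisms and under powers of degree coprime to the
exponent. -/
theorem eq_of_isRatConj [Finite G] {α : Type*} (S : G → Set α)
    (hφ : ∀ (φ : G ≃* G) g, S (φ g) ⊆ S g)
    (hp : ∀ r : ℤ, IsCoprime r (Monoid.exponent G) → ∀ g, S (g ^ r) ⊆ S g) {g g' : G}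
    (h : IsRatConj g g') : S g = S g' := by
  have key : ∀ g g', IsRatConj g g' → S g' ⊆ S g := by
    rintro g g' ⟨r, hr, hc⟩
    -- Units modulo `orderOf g` lift to units modulo the exponent, so `r` can be replaced by an
    -- exponent to which `hp` applies.
    obtain ⟨s, hs, hsr⟩ := exists_zpow_eq_of_coprime_orderOf hr
    obtain ⟨c, rfl⟩ := isConj_iff.1 hc
    rw [← hsr]
    exact (hφ (MulAut.conj c) (g ^ s)).trans (hp s hs g)
  exact (key _ _ (isRatConj_symm h)).antisymm (key _ _ h)

end Indicators
end DoubleIndicator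

theorem mainTheorem7 {G : Type*} [Group G] [Finite G] (m : ℤ) :
    (∀ (r : ℤ) (hr : IsCoprime r (Monoid.exponent G)) (g : G) (η : Irr (C g)),
      nu m (g ^ r) (Irr.transport (C_zpow hr g) η).1 = nu m g (adams r η.1) ∧
      ∃ hη : nu m g η.1 ∈ CF (Monoid.exponent G),
        nu m g (adams r η.1) = sigma (Monoid.exponent G) r hr ⟨nu m g η.1, hη⟩) ∧
    (∀ g g' : G, IsRatConj g g' →
      {x : ℂ | ∃ η : Irr (C g), x = nu m g η.1} = {x : ℂ | ∃ η : Irr (C g'), x = nu m g' η.1}) ∧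
    (∀ (r : ℤ) (hr : IsCoprime r (Monoid.exponent G)) (z : G) (χ : Irr (C z)),
      ∃ χr : Irr (C z), χr.1 = adams r χ.1 ∧
        beta m (z ^ r) (Irr.transport (C_zpow hr z) χ) = beta m z χr ∧
        ∃ hχ : beta m z χ ∈ CF (Monoid.exponent G),
          beta m z χr = sigma (Monoid.exponent G) r hr ⟨beta m z χ, hχ⟩) ∧
    (∀ z z' : G, IsRatConj z z' →
      {x : ℂ | ∃ χ : Irr (C z), x = beta m z χ} =
        {x : ℂ | ∃ χ : Irr (C z'), x = beta m z' χ}) := by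
  have hn : Monoid.exponent G ≠ 0 := Monoid.exponent_ne_zero_of_finite
  have hC : ∀ (g : G) (x : C g), x ^ Monoid.exponent G = 1 := fun g =>
    pow_exponent_eq_one_subgroup (C g)
  have htr : ∀ {H K : Subgroup G} (h : H = K) (χ : Irr K),
      Irr.transport h (Irr.transport h.symm χ) = χ := by
    rintro H _ rfl χ
    rfl
  refine ⟨fun r hr g η => ⟨nu_zpow m hr g η, ?_⟩, fun g g' h => ?_, fun r hr z χ =>
    ⟨⟨_, Irr.adams_mem (hC z) hr χ⟩, rfl, beta_zpow m hr z χ _ rfl, ?_⟩, fun z z' h => ?_⟩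
  · have := Fintype.ofFinite (C g)
    obtain ⟨τ, hσ, hτ⟩ := exists_ringEquiv_extends_sigma _ r hr
    have hmem : nu m g η.1 ∈ CF (Monoid.exponent G) := by
      rw [nu_eq_sum]
      exact sum_natCast_mul_mem_CF hn (hC g) _ _ id η
    refine ⟨hmem, ?_⟩
    rw [← hσ]
    change _ = τ (nu m g η.1)
    rw [nu_eq_sum, nu_eq_sum]
    exact (map_sum_natCast_mul hn (hC g) _ _ id η τ hτ).symm
  · refine eq_of_isRatConj (fun g => {x : ℂ | ∃ η : Irr (C g), x = nu m g η.1}) ?_ ?_ h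
    · rintro φ g _ ⟨η, rfl⟩
      exact ⟨⟨_, Irr.comp_mem (centralizerEquiv φ g) η⟩, (nu_map φ m g η.1).symm⟩
    · rintro r hr g _ ⟨η, rfl⟩
      -- The value of `η` at `g ^ r` is attained at `g` by `ψ^r η`, with `η` read on the equal
      -- subgroup `C g`.
      refine ⟨⟨_, Irr.adams_mem (hC g) hr (Irr.transport (C_zpow hr g).symm η)⟩, ?_⟩
      rw [← nu_zpow m hr, htr]
  · have := Fintype.ofFinite (C z)
    obtain ⟨τ, hσ, hτ⟩ := exists_ringEquiv_extends_sigma _ r hr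
    have hmem : beta m z χ ∈ CF (Monoid.exponent G) := by
      rw [beta_eq_sum]
      exact sum_natCast_mul_mem_CF hn (hC z) _ _ (·⁻¹) χ
    refine ⟨hmem, ?_⟩
    rw [← hσ]
    change _ = τ (beta m z χ)
    rw [beta_eq_sum, beta_eq_sum]
    exact (map_sum_natCast_mul hn (hC z) _ _ (·⁻¹) χ τ hτ).symm
  · refine eq_of_isRatConj (fun z => {x : ℂ | ∃ χ : Irr (C z), x = beta m z χ}) ?_ ?_ h
    · rintro φ z _ ⟨χ, rfl⟩
      exact ⟨_, (beta_map φ m z χ).symm⟩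
    · rintro r hr z _ ⟨χ, rfl⟩
      refine ⟨⟨_, Irr.adams_mem (hC z) hr (Irr.transport (C_zpow hr z).symm χ)⟩, ?_⟩
      rw [← beta_zpow m hr z _ _ rfl, htr]
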